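/- Fix $k\in\{2,3,\dots,\infty\}$ and let $G$ be a $C^k$ Lie group (a group that is a finite-dimensional Hausdorff second-countable $C^k$ manifold with $C^k$ operations) acting on $\mathbb{R}^n$ by a $C^k$ map $G\times\mathbb{R}^n\to\mathbb{R}^n$. Let $f:\mathbb{R}^n\to[-\infty,\infty]$ satisfy $f(gx)=f(x)$ for all $g\in G$, $x\in\mathbb{R}^n$, and let $\overline{x}\in\mathrm{dom}\, f=\{x: f(x)<\infty\}$. Assume that the action is typical at $\overline{x}$, that is: - it is proper near $\overline{x}$: there is a neighborhood $U$ of $\overline{x}$ such that $\{g\in G: U\cap gU\neq\emptyset\}$ has compact closure; and - the orbit type is constant near $\overline{x}$: for all $y$ near $\overline{x}$, the isotropy groups $G_y$ and $G_{\overline{x}}$ are conjugate in $G$. If $f(y)$ is finite, let $\widehat\partial f(y)$ be the set of $v\in\mathbb{R}^n$ with $f(z)\ge f(y)+\langle v,z-y\rangle+o(|z-y|)$ for $z$ near $y$; let $\partial f(y)$ be the set of limits $v$ of sequences $v_j\in\widehat\partial f(y_j)$ with $y_j\to y$ and $f(y_j)\to f(y)$; and let $\partial^\infty f(y)$ be the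 set of limits of $\tau_jv_j$ for such $y_j$, $v_j\in\widehat\partial f(y_j)$ (with $v_j$ not required to converge) and $\tau_j>0$, $\tau_j\to0$. If $f(y)$ is not finite, these sets are empty. Let $T_xGx\subseteq\mathbb{R}^n$ be the tangent space at $x$ to the orbit $Gx$, i.e. the image of the differential at the identity of $g\mapsto gx$, and let $P_{T_xGx}$ be the orthogonal projection onto it. Then there exist a constant $C$ and a neighborhood $U$ of $\overline{x}$ such that, for all $x\in U\cap\mathrm{dom}\, f$ and all $y\in U$, $$\forall v\in\partial f(y),\quad |P_{T_xGx}(v)|\le C\,|x-y|\,|v|\qquad\text{and}\qquad \forall w\in\partial^\infty f(y),\quad |P_{T_xGx}(w)|\le C\,|x-y|\,|w|.$$ The points $x$ and $y$ may lie on different orbits. -/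

import Mathlib

open Filter Topology
open scoped Manifold ContDiff

namespace OrbitalProjection

section Actions

variable {G X : Type*} [Group G] [MulAction G X]

/-- The conjugacy class of a subgroup `H` of `G`: the set of all subgroups `g H g⁻¹`. -/
def subgroupConjClass (H : Subgroup G) : Set (Subgroup G) :=
  {K | ∃ g : G, K = H.map (MulAut.conj g).toMonoidHom}

/-- The type of the orbit of `x`: the conjugacy class of the isotropy group of `x`. -/
def orbitType (G : Type*) [Group G] [MulAction G X] (x : X) : Set (Subgroup G) :=
  subgroupConjClass (MulAction.stabilizer G x)

/-- The action is proper near `x`: there is a neighborhood `U` of `x` for which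
`{g : U ∩ gU ≠ ∅}` has compact closure. -/
def ProperNear (G : Type*) [Group G] [TopologicalSpace G] [TopologicalSpace X] [MulAction G X]
    (x : X) : Prop :=
  ∃ U ∈ 𝓝 x, IsCompact (closure {g : G | (U ∩ (fun u : X => g • u) '' U).Nonempty})

/-- The action is typical at `x`: it is proper near `x` and the orbit type is constant near `x`. -/
def TypicalAt (G : Type*) [Group G] [TopologicalSpace G] [TopologicalSpace X] [MulAction G X]
    (x : X) : Prop :=
  ProperNear G x ∧ ∀ᶠ y in 𝓝 x, orbitType G y = orbitType G x

end Actions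

/-- The tangent space `T_x(Gx) ⊆ ℝⁿ` at `x` to the orbit of `x` under a smooth action of a Lie
group `G` on `ℝⁿ`. The orbit is the immersed submanifold parametrized by the injective immersion
`G / G_x → ℝⁿ` induced by the orbit map `g ↦ g x`; as `G → G / G_x` is a submersion, its tangent
space at `x` is the range of the derivative of the orbit map at the identity. -/
noncomputable def orbitTangentSpace {d n : ℕ} (G : Type*) [Group G] [TopologicalSpace G]
    [ChartedSpace (EuclideanSpace ℝ (Fin d)) G] [MulAction G (EuclideanSpace ℝ (Fin n))]
    (x : EuclideanSpace ℝ (Fin n)) : Submodule ℝ (EuclideanSpace ℝ (Fin n)) :=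
  LinearMap.range
    (mfderiv 𝓘(ℝ, EuclideanSpace ℝ (Fin d)) 𝓘(ℝ, EuclideanSpace ℝ (Fin n))
      (fun g : G => g • x) 1).toLinearMap

section Subdifferentials

variable {n : ℕ}

/-- The regular subdifferential: vectors `v` with
`f z ≥ f x + ⟪v, z - x⟫ + o(‖z - x‖)` for `z` near `x`; it is empty if `f x` is not finite. -/
def regularSubdifferential (f : EuclideanSpace ℝ (Fin n) → EReal)
    (x : EuclideanSpace ℝ (Fin n)) : Set (EuclideanSpace ℝ (Fin n)) :=
  {v | f x ≠ ⊥ ∧ f x ≠ ⊤ ∧ ∀ ε : ℝ, 0 < ε → ∀ᶠ z in 𝓝 x,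
    f x + ((inner ℝ v (z - x) - ε * ‖z - x‖ : ℝ) : EReal) ≤ f z}

/-- The (limiting) subdifferential; it is empty if `f x` is not finite. -/
def subdifferential (f : EuclideanSpace ℝ (Fin n) → EReal)
    (x : EuclideanSpace ℝ (Fin n)) : Set (EuclideanSpace ℝ (Fin n)) :=
  {v | f x ≠ ⊥ ∧ f x ≠ ⊤ ∧ ∃ xs vs : ℕ → EuclideanSpace ℝ (Fin n),
    (∀ k, vs k ∈ regularSubdifferential f (xs k)) ∧
    Tendsto xs atTop (𝓝 x) ∧ Tendsto (fun k => f (xs k)) atTop (𝓝 (f x)) ∧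
    Tendsto vs atTop (𝓝 v)}

/-- The horizon subdifferential; it is empty if `f x` is not finite. -/
def horizonSubdifferential (f : EuclideanSpace ℝ (Fin n) → EReal)
    (x : EuclideanSpace ℝ (Fin n)) : Set (EuclideanSpace ℝ (Fin n)) :=
  {v | f x ≠ ⊥ ∧ f x ≠ ⊤ ∧ ∃ (xs vs : ℕ → EuclideanSpace ℝ (Fin n)) (τ : ℕ → ℝ),
    (∀ k, vs k ∈ regularSubdifferential f (xs k)) ∧
    (∀ k, 0 < τ k) ∧ Tendsto τ atTop (𝓝 0) ∧
    Tendsto xs atTop (𝓝 x) ∧ Tendsto (fun k => f (xs k)) atTop (𝓝 (f x)) ∧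
    Tendsto (fun k => τ k • vs k) atTop (𝓝 v)}

end Subdifferentials

end OrbitalProjection

/-! Let `A x` be the derivative at the identity of `g ↦ g • x`, with range the orbit's tangent
space. A regular subgradient `v` at `y` is orthogonal to the range of `A y`, because `f` is constant
on orbits. If `p` is the projection of `v` onto the range of `A x` and `p = A x h`, then `‖p‖² = ⟪v,
A x h⟫ = ⟪v, (A x - A y) h⟫`. The action is `C²`, so `A` is locally Lipschitz; it remains to choose
`h` with `‖h‖ ≤ C ‖p‖` uniformly.

Such a choice exists if the rank of `A` does not jump up near the base point
(`exists_bounded_preimage_of_finrank_range_le`). Constant orbit type ensures this: `ker (A x)` is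
determined by the isotropy group of `x`, and moving along an orbit does not raise the rank. The
estimate is homogeneous in `v` and closed under limits, so it passes to both limiting
subdifferentials. -/

namespace OrbitalProjection

open Module

/-! ### Linear algebra: uniformly bounded preimages -/

section BoundedPreimage

variable {X E F : Type*} [TopologicalSpace X]
  [NormedAddCommGroup E] [NormedSpace ℝ E] [FiniteDimensional ℝ E]
  [NormedAddCommGroup F] [NormedSpace ℝ F]

/-- If the rank of a continuous family of linear maps does not increase near a point, then vectors
in the ranges of nearby maps have preimages of proportional norm. -/
theorem exists_bounded_preimage_of_finrank_range_le {A : X → E →L[ℝ] F} {x₀ : X}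
    (hA : ContinuousAt A x₀)
    (hrank : ∀ᶠ x in 𝓝 x₀, finrank ℝ (LinearMap.range (A x).toLinearMap)
      ≤ finrank ℝ (LinearMap.range (A x₀).toLinearMap)) :
    ∃ C : ℝ, 0 < C ∧ ∀ᶠ x in 𝓝 x₀, ∀ u ∈ LinearMap.range (A x).toLinearMap,
      ∃ h, A x h = u ∧ ‖h‖ ≤ C * ‖u‖ := by
  obtain ⟨K, hK⟩ := Submodule.exists_isCompl (LinearMap.ker (A x₀).toLinearMap)
  have hinj : LinearMap.ker ((A x₀).toLinearMap.domRestrict K) = ⊥ := by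
    rw [LinearMap.ker_eq_bot']
    rintro ⟨h, hh⟩ h0
    have : h ∈ LinearMap.ker (A x₀).toLinearMap ⊓ K := ⟨h0, hh⟩
    rw [hK.inf_eq_bot] at this
    simpa using this
  obtain ⟨c, hc, hanti⟩ := LinearMap.exists_antilipschitzWith _ hinj
  have hc' : (0 : ℝ) < c := hc
  have hbound : ∀ h ∈ K, ‖h‖ ≤ c * ‖A x₀ h‖ := fun h hh => by
    simpa [dist_eq_norm] using hanti.le_mul_dist ⟨h, hh⟩ 0
  have hfin : finrank ℝ K = finrank ℝ (LinearMap.range (A x₀).toLinearMap) := by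
    have h1 := Submodule.finrank_add_eq_of_isCompl hK
    have h2 := (A x₀).toLinearMap.finrank_range_add_finrank_ker
    omega
  -- A perturbation of this size costs at most half of the lower bound `1 / c` of `A x₀` on `K`.
  have hclose : ∀ᶠ x in 𝓝 x₀, ‖A x - A x₀‖ < 1 / (2 * c) := by
    have := Metric.continuousAt_iff'.1 hA (1 / (2 * c)) (by positivity)
    simpa [dist_eq_norm] using this
  refine ⟨2 * c, by positivity, ?_⟩
  filter_upwards [hrank, hclose] with x hx hx'
  have hlow : ∀ h ∈ K, ‖h‖ ≤ 2 * c * ‖A x h‖ := fun h hh => by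
    have h1 := hbound h hh
    have h2 : ‖A x₀ h‖ ≤ ‖A x h‖ + 1 / (2 * c) * ‖h‖ := by
      calc ‖A x₀ h‖ = ‖A x h - (A x - A x₀) h‖ := by simp
        _ ≤ ‖A x h‖ + ‖(A x - A x₀) h‖ := norm_sub_le _ _
        _ ≤ _ := by
          gcongr
          exact ((A x - A x₀).le_opNorm h).trans (by gcongr)
    have h3 : c * ‖A x₀ h‖ ≤ c * ‖A x h‖ + ‖h‖ / 2 := by
      refine (mul_le_mul_of_nonneg_left h2 hc'.le).trans_eq ?_
      field_simp
    linarith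
  have hinj' : Function.Injective ((A x).toLinearMap.domRestrict K) := by
    rw [← LinearMap.ker_eq_bot, LinearMap.ker_eq_bot']
    rintro ⟨h, hh⟩ h0
    have h0' : A x h = 0 := h0
    have := hlow h hh
    rw [h0', norm_zero, mul_zero] at this
    simpa using this
  -- `A x` is injective on `K`, so the image of `K` has dimension `rank (A x₀) ≥ rank (A x)` and
  -- fills the range.
  have hrange : LinearMap.range ((A x).toLinearMap.domRestrict K)
      = LinearMap.range (A x).toLinearMap := by
    refine Submodule.eq_of_le_of_finrank_le ?_ ?_
    · rintro _ ⟨h, rfl⟩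
      exact ⟨h, rfl⟩
    · rw [LinearMap.finrank_range_of_inj hinj', hfin]
      exact hx
  intro u hu
  rw [← hrange] at hu
  obtain ⟨⟨h, hh⟩, rfl⟩ := hu
  exact ⟨h, rfl, hlow h hh⟩

end BoundedPreimage

/-! ### Derivatives of orbit maps and isotropy groups -/

section OrbitMap

open ContinuousLinearMap

variable {E F G : Type*} [NormedAddCommGroup E] [NormedSpace ℝ E]
  [NormedAddCommGroup F] [NormedSpace ℝ F]
  [Group G] [TopologicalSpace G] [ChartedSpace E G] [MulAction G F]

variable (E G) in
/-- The derivative at the identity of the orbit map `g ↦ g x`. -/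
noncomputable def orbitDeriv (x : F) : E →L[ℝ] F :=
  mfderiv 𝓘(ℝ, E) 𝓘(ℝ, F) (fun g : G => g • x) 1

theorem mdifferentiableAt_orbitMap
    (hsmooth : ContMDiff (𝓘(ℝ, E).prod 𝓘(ℝ, F)) 𝓘(ℝ, F) 2 (fun p : G × F => p.1 • p.2))
    (x : F) (g : G) : MDifferentiableAt 𝓘(ℝ, E) 𝓘(ℝ, F) (fun g : G => g • x) g :=
  (hsmooth.comp (contMDiff_id.prodMk contMDiff_const)).mdifferentiable two_ne_zero g

theorem mdifferentiableAt_smul_left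
    (hsmooth : ContMDiff (𝓘(ℝ, E).prod 𝓘(ℝ, F)) 𝓘(ℝ, F) 2 (fun p : G × F => p.1 • p.2))
    (g : G) (x : F) : MDifferentiableAt 𝓘(ℝ, F) 𝓘(ℝ, F) (fun x : F => g • x) x :=
  (hsmooth.comp (contMDiff_const.prodMk contMDiff_id)).mdifferentiable two_ne_zero x

theorem hasFDerivAt_chart_orbitMap
    (hsmooth : ContMDiff (𝓘(ℝ, E).prod 𝓘(ℝ, F)) 𝓘(ℝ, F) 2 (fun p : G × F => p.1 • p.2))
    (x : F) : HasFDerivAt (fun e : E => (extChartAt 𝓘(ℝ, E) (1 : G)).symm e • x)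
      (orbitDeriv E G x) (extChartAt 𝓘(ℝ, E) (1 : G) 1) := by
  have h := (mdifferentiableAt_orbitMap hsmooth x (1 : G)).hasMFDerivAt.2
  rw [modelWithCornersSelf_coe, Set.range_id] at h
  exact hasFDerivWithinAt_univ.1 h

theorem hasDerivAt_smul_of_hasMFDerivAt {γ : ℝ → G} {t : ℝ} {ξ : E} {x : F} {A : E →L[ℝ] F}
    (hγ : HasMFDerivAt 𝓘(ℝ, ℝ) 𝓘(ℝ, E) γ t ((1 : ℝ →L[ℝ] ℝ).smulRight ξ))
    (hA : HasMFDerivAt 𝓘(ℝ, E) 𝓘(ℝ, F) (fun g : G => g • x) (γ t) A) :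
    HasDerivAt (fun s => γ s • x) (A ξ) t := by
  have h : HasFDerivAt (fun s => γ s • x) (A.comp ((1 : ℝ →L[ℝ] ℝ).smulRight ξ)) t :=
    hasMFDerivAt_iff_hasFDerivAt.1 (HasMFDerivAt.comp t hA hγ)
  simpa using h.hasDerivAt

variable [LieGroup 𝓘(ℝ, E) 2 G]

/-- The action read in a chart at the identity is `C²` near the identity. -/
theorem contDiffAt_chart_smul
    (hsmooth : ContMDiff (𝓘(ℝ, E).prod 𝓘(ℝ, F)) 𝓘(ℝ, F) 2 (fun p : G × F => p.1 • p.2))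
    (x : F) : ContDiffAt ℝ 2
      (fun p : E × F => (extChartAt 𝓘(ℝ, E) (1 : G)).symm p.1 • p.2)
      (extChartAt 𝓘(ℝ, E) (1 : G) 1, x) := by
  have hM : IsManifold 𝓘(ℝ, E) 2 G := inferInstance
  have h1 : ContMDiffAt 𝓘(ℝ, E) 𝓘(ℝ, E) 2 (extChartAt 𝓘(ℝ, E) (1 : G)).symm
      (extChartAt 𝓘(ℝ, E) (1 : G) 1) :=
    (contMDiffOn_extChartAt_symm (1 : G)).contMDiffAt (extChartAt_target_mem_nhds _)
  have h2 : ContMDiffAt 𝓘(ℝ, E × F) 𝓘(ℝ, E) 2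
      (fun p : E × F => (extChartAt 𝓘(ℝ, E) (1 : G)).symm p.1)
      (extChartAt 𝓘(ℝ, E) (1 : G) 1, x) :=
    ContMDiffAt.comp (I' := 𝓘(ℝ, E)) (extChartAt 𝓘(ℝ, E) (1 : G) 1, x) h1
      contDiff_fst.contMDiff.contMDiffAt
  have h3 : ContMDiffAt 𝓘(ℝ, E × F) 𝓘(ℝ, F) 2 (fun p : E × F => p.2)
      (extChartAt 𝓘(ℝ, E) (1 : G) 1, x) := contDiff_snd.contMDiff.contMDiffAt
  exact (hsmooth.contMDiffAt.comp _ (h2.prodMk h3)).contDiffAt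

/-- The derivative of the orbit map at the identity is locally Lipschitz in the base point. -/
theorem exists_lipschitzOnWith_orbitDeriv
    (hsmooth : ContMDiff (𝓘(ℝ, E).prod 𝓘(ℝ, F)) 𝓘(ℝ, F) 2 (fun p : G × F => p.1 • p.2))
    (x₀ : F) : ∃ L, ∃ t ∈ 𝓝 x₀, LipschitzOnWith L (orbitDeriv E G : F → E →L[ℝ] F) t := by
  have hd := fun x => contDiffAt_chart_smul hsmooth x
  -- In a chart this is a partial derivative of a `C²` map, hence `C¹` in `x`.
  have heq : (orbitDeriv E G : F → E →L[ℝ] F) = fun x =>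
      (fderiv ℝ (fun p : E × F => (extChartAt 𝓘(ℝ, E) (1 : G)).symm p.1 • p.2)
        (extChartAt 𝓘(ℝ, E) (1 : G) 1, x)).comp (inl ℝ E F) := by
    funext x
    have h := HasFDerivAt.comp (f := fun e : E => (e, x)) (extChartAt 𝓘(ℝ, E) (1 : G) 1)
      ((hd x).differentiableAt two_ne_zero).hasFDerivAt (hasFDerivAt_prodMk_left _ x)
    exact (hasFDerivAt_chart_orbitMap hsmooth x).unique h
  rw [heq]
  apply ContDiffAt.exists_lipschitzOnWith (𝕂 := ℝ)
  have h1 : ContDiffAt ℝ 1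
      (fderiv ℝ (fun p : E × F => (extChartAt 𝓘(ℝ, E) (1 : G)).symm p.1 • p.2))
      (extChartAt 𝓘(ℝ, E) (1 : G) 1, x₀) := (hd x₀).fderiv_right (by norm_num)
  have h2 := h1.comp x₀ (contDiffAt_const.prodMk contDiffAt_id :
    ContDiffAt ℝ 1 (fun x : F => (extChartAt 𝓘(ℝ, E) (1 : G) 1, x)) x₀)
  exact h2.clm_comp contDiffAt_const

/-- The rank of the orbit map does not increase along an orbit. -/
theorem finrank_range_orbitDeriv_smul_le [FiniteDimensional ℝ F]
    (hsmooth : ContMDiff (𝓘(ℝ, E).prod 𝓘(ℝ, F)) 𝓘(ℝ, F) 2 (fun p : G × F => p.1 • p.2))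
    (g : G) (x : F) :
    finrank ℝ (LinearMap.range (orbitDeriv E G (g • x)).toLinearMap)
      ≤ finrank ℝ (LinearMap.range (orbitDeriv E G x).toLinearMap) := by
  -- Differentiate `h • (g • x) = g • ((g⁻¹ * h * g) • x)` at `h = 1`.
  have hconj : MDifferentiableAt 𝓘(ℝ, E) 𝓘(ℝ, E) (fun h : G => g⁻¹ * h * g) 1 :=
    ((contMDiff_mul_right (I := 𝓘(ℝ, E)) (n := 2) (a := g)).comp
      (contMDiff_mul_left (I := 𝓘(ℝ, E)) (n := 2) (a := g⁻¹))).mdifferentiable two_ne_zero 1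
  have hone : g⁻¹ * 1 * g = 1 := by simp
  have horb : HasMFDerivAt 𝓘(ℝ, E) 𝓘(ℝ, F) (fun h : G => h • x) (g⁻¹ * 1 * g)
      (orbitDeriv E G x : E →L[ℝ] F) := by
    rw [hone]
    exact (mdifferentiableAt_orbitMap hsmooth x (1 : G)).hasMFDerivAt
  have hsm : HasMFDerivAt 𝓘(ℝ, F) 𝓘(ℝ, F) (fun y : F => g • y) ((g⁻¹ * 1 * g) • x)
      (mfderiv 𝓘(ℝ, F) 𝓘(ℝ, F) (fun y : F => g • y) ((g⁻¹ * 1 * g) • x)) :=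
    (mdifferentiableAt_smul_left hsmooth g _).hasMFDerivAt
  have hcomp := HasMFDerivAt.comp (1 : G) hsm (HasMFDerivAt.comp (1 : G) horb hconj.hasMFDerivAt)
  have hfun : (fun y : F => g • y) ∘ (fun h : G => h • x) ∘ (fun h : G => g⁻¹ * h * g)
      = fun h : G => h • (g • x) := by
    funext h
    simp [smul_smul, mul_assoc]
  rw [hfun] at hcomp
  have heq := hcomp.mfderiv
  let D : F →ₗ[ℝ] F :=
    (mfderiv 𝓘(ℝ, F) 𝓘(ℝ, F) (fun y : F => g • y) ((g⁻¹ * 1 * g) • x)).toLinearMap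
  have hle : LinearMap.range (orbitDeriv E G (g • x)).toLinearMap
      ≤ (LinearMap.range (orbitDeriv E G x).toLinearMap).map D := by
    rintro _ ⟨ξ, rfl⟩
    refine ⟨_, ⟨mfderiv 𝓘(ℝ, E) 𝓘(ℝ, E) (fun h : G => g⁻¹ * h * g) 1 ξ, rfl⟩, ?_⟩
    exact (DFunLike.congr_fun heq ξ).symm
  exact (Submodule.finrank_mono hle).trans (Submodule.finrank_map_le D _)

/-- Left-invariant vector fields on a `C²` Lie group are `C¹`. -/
theorem contMDiff_one_mulInvariantVectorField (ξ : GroupLieAlgebra 𝓘(ℝ, E) G) :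
    ContMDiff 𝓘(ℝ, E) 𝓘(ℝ, E).tangent 1
      (fun g : G => (mulInvariantVectorField ξ g : TangentBundle 𝓘(ℝ, E) G)) := by
  -- The field is the tangent map of multiplication applied to `(0_g, ξ)`; differentiating costs one
  -- order of smoothness.
  let S₁ : G → TangentBundle 𝓘(ℝ, E) G × TangentBundle 𝓘(ℝ, E) G :=
    fun g => (Bundle.TotalSpace.mk' E g 0, Bundle.TotalSpace.mk' E 1 ξ)
  have hS₁ : ContMDiff 𝓘(ℝ, E) (𝓘(ℝ, E).tangent.prod 𝓘(ℝ, E).tangent) 1 S₁ :=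
    (Bundle.contMDiff_zeroSection _ _).prodMk contMDiff_const
  let S₂ : TangentBundle 𝓘(ℝ, E) G × TangentBundle 𝓘(ℝ, E) G →
      TangentBundle (𝓘(ℝ, E).prod 𝓘(ℝ, E)) (G × G) :=
    (equivTangentBundleProd 𝓘(ℝ, E) G 𝓘(ℝ, E) G).symm
  have hS₂ : ContMDiff (𝓘(ℝ, E).tangent.prod 𝓘(ℝ, E).tangent)
      (𝓘(ℝ, E).prod 𝓘(ℝ, E)).tangent 1 S₂ := contMDiff_equivTangentBundleProd_symm
  let S₃ : TangentBundle (𝓘(ℝ, E).prod 𝓘(ℝ, E)) (G × G) → TangentBundle 𝓘(ℝ, E) G :=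
    tangentMap (𝓘(ℝ, E).prod 𝓘(ℝ, E)) 𝓘(ℝ, E) (fun p : G × G => p.1 * p.2)
  have hS₃ : ContMDiff (𝓘(ℝ, E).prod 𝓘(ℝ, E)).tangent 𝓘(ℝ, E).tangent 1 S₃ := by
    apply ContMDiff.contMDiff_tangentMap _ (m := 1) le_rfl
    rw [one_add_one_eq_two]
    exact contMDiff_mul 𝓘(ℝ, E) 2
  convert! (hS₃.comp hS₂).comp hS₁ with g
  · simp [S₁, S₂, S₃]
  · simp only [Function.comp_apply, tangentMap, S₃, S₂, S₁]
    rw [mfderiv_prod_eq_add_apply ((contMDiff_mul 𝓘(ℝ, E) 2).mdifferentiable two_ne_zero _)]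
    exact ((congrArg (· + _) (map_zero _)).trans (zero_add _)).symm

/-- The kernel of the derivative of the orbit map of `x` consists of velocities of curves in the
isotropy group of `x`. -/
theorem exists_curve_stabilizer_of_orbitDeriv_eq_zero [CompleteSpace E]
    (hsmooth : ContMDiff (𝓘(ℝ, E).prod 𝓘(ℝ, F)) 𝓘(ℝ, F) 2 (fun p : G × F => p.1 • p.2))
    {x : F} {ξ : E} (hξ : orbitDeriv E G x ξ = 0) :
    ∃ γ : ℝ → G, γ 0 = 1 ∧
      HasMFDerivAt 𝓘(ℝ, ℝ) 𝓘(ℝ, E) γ 0 ((1 : ℝ →L[ℝ] ℝ).smulRight ξ) ∧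
      ∀ᶠ t in 𝓝 0, γ t ∈ MulAction.stabilizer G x := by
  obtain ⟨γ, h0, hγ⟩ := exists_isMIntegralCurveAt_of_contMDiffAt_boundaryless (t₀ := 0)
    (contMDiff_one_mulInvariantVectorField (E := E) (G := G) ξ).contMDiffAt (x₀ := 1)
  have hid : mulInvariantVectorField (I := 𝓘(ℝ, E)) (G := G) ξ 1 = ξ := by
    have h := ((hasMFDerivAt_id (I := 𝓘(ℝ, E)) (1 : G)).congr_of_eventuallyEq
      (f₁ := fun h : G => 1 * h) (Eventually.of_forall fun h => one_mul h)).mfderiv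
    exact DFunLike.congr_fun h ξ
  have hvel := hγ.hasMFDerivAt
  -- Since `(g * h) • x = g • (h • x)`, the orbit map kills the left-invariant field of `ξ`
  -- everywhere once it kills `ξ`. Hence `γ t • x` is constant along the integral curve.
  have hfield : ∀ g : G, mfderiv 𝓘(ℝ, E) 𝓘(ℝ, F) (fun h : G => h • x) g
      (mulInvariantVectorField (I := 𝓘(ℝ, E)) ξ g) = 0 := fun g => by
    have hl : MDifferentiableAt 𝓘(ℝ, E) 𝓘(ℝ, E) (fun h : G => g * h) 1 :=
      (contMDiff_mul_left (I := 𝓘(ℝ, E)) (n := 2) (a := g)).mdifferentiable two_ne_zero 1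
    have horb : HasMFDerivAt 𝓘(ℝ, E) 𝓘(ℝ, F) (fun h : G => h • x) (g * 1)
        (mfderiv 𝓘(ℝ, E) 𝓘(ℝ, F) (fun h : G => h • x) (g * 1)) :=
      (mdifferentiableAt_orbitMap hsmooth x _).hasMFDerivAt
    have h1 := (HasMFDerivAt.comp (1 : G) horb hl.hasMFDerivAt).mfderiv
    have h2 := (HasMFDerivAt.comp (1 : G)
      (mdifferentiableAt_smul_left hsmooth g ((1 : G) • x)).hasMFDerivAt
      (mdifferentiableAt_orbitMap hsmooth x (1 : G)).hasMFDerivAt).mfderiv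
    have hfun : (fun h : G => h • x) ∘ (fun h : G => g * h)
        = (fun y : F => g • y) ∘ (fun h : G => h • x) := by
      funext h
      simp [mul_smul]
    rw [hfun, h2] at h1
    have h3 := DFunLike.congr_fun h1 ξ
    have h4 : mfderiv 𝓘(ℝ, F) 𝓘(ℝ, F) (fun y : F => g • y) ((1 : G) • x)
        (orbitDeriv E G x ξ) = 0 := by
      rw [hξ]
      exact map_zero _
    have h5 : mfderiv 𝓘(ℝ, E) 𝓘(ℝ, F) (fun h : G => h • x) (g * 1)
      (mulInvariantVectorField (I := 𝓘(ℝ, E)) ξ g) = 0 := h3.symm.trans h4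
    rwa [mul_one] at h5
  refine ⟨γ, h0, ?_, ?_⟩
  · rw [h0, hid] at hvel
    exact hvel
  obtain ⟨ε, hε, hball⟩ := Metric.eventually_nhds_iff_ball.1 hγ
  have hderiv : ∀ t ∈ Metric.ball (0 : ℝ) ε, HasDerivAt (fun t => γ t • x) 0 t := fun t ht => by
    exact (hasDerivAt_smul_of_hasMFDerivAt (hball t ht)
      (mdifferentiableAt_orbitMap hsmooth x (γ t)).hasMFDerivAt).congr_deriv (hfield _)
  filter_upwards [Metric.ball_mem_nhds (0 : ℝ) hε] with t ht
  have := Metric.isOpen_ball.is_const_of_deriv_eq_zero (convex_ball (0 : ℝ) ε).isPreconnected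
    (fun s hs => (hderiv s hs).differentiableAt.differentiableWithinAt)
    (fun s hs => (hderiv s hs).deriv) ht (Metric.mem_ball_self hε)
  simpa [h0] using this

/-- The kernel of the derivative of the orbit map depends only on the isotropy group. -/
theorem ker_orbitDeriv_le_of_stabilizer_eq [CompleteSpace E]
    (hsmooth : ContMDiff (𝓘(ℝ, E).prod 𝓘(ℝ, F)) 𝓘(ℝ, F) 2 (fun p : G × F => p.1 • p.2))
    {x y : F} (hxy : MulAction.stabilizer G x = MulAction.stabilizer G y) :
    LinearMap.ker (orbitDeriv E G x).toLinearMap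
      ≤ LinearMap.ker (orbitDeriv E G y).toLinearMap := by
  intro ξ hξ
  obtain ⟨γ, h0, hγ, hstab⟩ := exists_curve_stabilizer_of_orbitDeriv_eq_zero hsmooth
    (show orbitDeriv E G x ξ = 0 from hξ)
  have horb : HasMFDerivAt 𝓘(ℝ, E) 𝓘(ℝ, F) (fun h : G => h • y) (γ 0)
      (orbitDeriv E G y : E →L[ℝ] F) := by
    rw [h0]
    exact (mdifferentiableAt_orbitMap hsmooth y (1 : G)).hasMFDerivAt
  have hcomp : HasDerivAt (fun t => γ t • y) (orbitDeriv E G y ξ) 0 :=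
    hasDerivAt_smul_of_hasMFDerivAt hγ horb
  have hconst : (fun t => γ t • y) =ᶠ[𝓝 0] fun _ => y := by
    filter_upwards [hstab] with t ht
    rw [hxy] at ht
    exact ht
  exact hcomp.unique ((hasDerivAt_const (0 : ℝ) y).congr_of_eventuallyEq hconst)

/-- If the orbit type is constant near a point, then the rank of the orbit maps does not increase
near that point. -/
theorem eventually_finrank_range_orbitDeriv_le [FiniteDimensional ℝ E] [FiniteDimensional ℝ F]
    (hsmooth : ContMDiff (𝓘(ℝ, E).prod 𝓘(ℝ, F)) 𝓘(ℝ, F) 2 (fun p : G × F => p.1 • p.2))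
    {x₀ : F} (htype : ∀ᶠ y in 𝓝 x₀, orbitType G y = orbitType G x₀) :
    ∀ᶠ y in 𝓝 x₀, finrank ℝ (LinearMap.range (orbitDeriv E G y).toLinearMap)
      ≤ finrank ℝ (LinearMap.range (orbitDeriv E G x₀).toLinearMap) := by
  have := FiniteDimensional.complete ℝ E
  filter_upwards [htype] with y hy
  have hmem : MulAction.stabilizer G y ∈ orbitType G y := by
    refine ⟨1, ?_⟩
    rw [← MulAction.stabilizer_smul_eq_stabilizer_map_conj, one_smul]
  rw [hy] at hmem
  obtain ⟨g, hg⟩ := hmem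
  rw [← MulAction.stabilizer_smul_eq_stabilizer_map_conj] at hg
  -- The isotropy group of `y` is that of `g • x₀`; rank–nullity turns the kernel inclusion into a
  -- rank bound.
  have hker := Submodule.finrank_mono (ker_orbitDeriv_le_of_stabilizer_eq (E := E) hsmooth hg.symm)
  have h1 := (orbitDeriv E G (g • x₀)).toLinearMap.finrank_range_add_finrank_ker
  have h2 := (orbitDeriv E G y).toLinearMap.finrank_range_add_finrank_ker
  have h3 := finrank_range_orbitDeriv_smul_le (E := E) hsmooth g x₀
  omega

end OrbitMap

/-! ### Regular subgradients of invariant functions -/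

section Subgradients

variable {d n : ℕ} {G : Type*} [Group G] [TopologicalSpace G]
  [ChartedSpace (EuclideanSpace ℝ (Fin d)) G] [MulAction G (EuclideanSpace ℝ (Fin n))]

/-- Regular subgradients of an invariant function are orthogonal to orbits. -/
theorem inner_orbitDeriv_eq_zero_of_mem_regularSubdifferential
    (hsmooth : ContMDiff
      (𝓘(ℝ, EuclideanSpace ℝ (Fin d)).prod 𝓘(ℝ, EuclideanSpace ℝ (Fin n)))
      𝓘(ℝ, EuclideanSpace ℝ (Fin n)) 2 (fun p : G × EuclideanSpace ℝ (Fin n) => p.1 • p.2))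
    {f : EuclideanSpace ℝ (Fin n) → EReal}
    (hinv : ∀ (g : G) (x : EuclideanSpace ℝ (Fin n)), f (g • x) = f x)
    {y v : EuclideanSpace ℝ (Fin n)} (hv : v ∈ regularSubdifferential f y)
    (ξ : EuclideanSpace ℝ (Fin d)) :
    inner ℝ v (orbitDeriv (EuclideanSpace ℝ (Fin d)) G y ξ) = 0 := by
  obtain ⟨hbot, htop, hv⟩ := hv
  set e₀ : EuclideanSpace ℝ (Fin d) := extChartAt 𝓘(ℝ, EuclideanSpace ℝ (Fin d)) (1 : G) 1 with he₀
  -- Along a curve `ψ` in the orbit, `f` cancels from the subgradient inequality; divide by `t`,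
  -- then let `t` and `ε` tend to `0`. Applying this to `-ξ` gives equality.
  have hle : ∀ ξ, inner ℝ v (orbitDeriv (EuclideanSpace ℝ (Fin d)) G y ξ) ≤ 0 := fun ξ => by
    let ψ : ℝ → EuclideanSpace ℝ (Fin n) := fun t =>
      (extChartAt 𝓘(ℝ, EuclideanSpace ℝ (Fin d)) (1 : G)).symm (e₀ + t • ξ) • y
    have hψ0 : ψ 0 = y := by simp [ψ, he₀]
    have hψ : HasDerivAt ψ (orbitDeriv (EuclideanSpace ℝ (Fin d)) G y ξ) 0 := by
      have hline : HasDerivAt (fun t : ℝ => e₀ + t • ξ) ξ 0 := by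
        simpa using ((hasDerivAt_id (0 : ℝ)).smul_const ξ).const_add e₀
      have hφ : HasFDerivAt (fun e : EuclideanSpace ℝ (Fin d) =>
          (extChartAt 𝓘(ℝ, EuclideanSpace ℝ (Fin d)) (1 : G)).symm e • y)
          (orbitDeriv (EuclideanSpace ℝ (Fin d)) G y) (e₀ + (0 : ℝ) • ξ) := by
        rw [zero_smul, add_zero]
        exact hasFDerivAt_chart_orbitMap hsmooth y
      exact hφ.comp_hasDerivAt (0 : ℝ) hline
    have hslope := hψ.tendsto_slope_zero_right
    have hcont : Tendsto ψ (𝓝[>] 0) (𝓝 y) := by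
      have := hψ.continuousAt.tendsto
      rw [hψ0] at this
      exact this.mono_left nhdsWithin_le_nhds
    have hε : ∀ ε : ℝ, 0 < ε → inner ℝ v (orbitDeriv (EuclideanSpace ℝ (Fin d)) G y ξ)
        ≤ ε * ‖orbitDeriv (EuclideanSpace ℝ (Fin d)) G y ξ‖ := fun ε hε => by
      refine le_of_tendsto_of_tendsto (tendsto_const_nhds.inner hslope)
        (hslope.norm.const_mul ε) ?_
      filter_upwards [hcont.eventually (hv ε hε), self_mem_nhdsWithin] with t ht ht0
      have ht0' : (0 : ℝ) < t := ht0
      rw [hinv] at ht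
      lift f y to ℝ using ⟨htop, hbot⟩ with a
      have hreal : inner ℝ v (ψ t - y) ≤ ε * ‖ψ t - y‖ := by
        have : a + (inner ℝ v (ψ t - y) - ε * ‖ψ t - y‖) ≤ a := by exact_mod_cast ht
        linarith
      rw [zero_add, hψ0, inner_smul_right, norm_smul, norm_inv, Real.norm_of_nonneg ht0'.le]
      calc t⁻¹ * inner ℝ v (ψ t - y) ≤ t⁻¹ * (ε * ‖ψ t - y‖) := by gcongr
        _ = ε * (t⁻¹ * ‖ψ t - y‖) := by ring
    refine le_of_forall_pos_le_add fun δ hδ => ?_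
    -- The `+ 1` covers a vanishing derivative.
    have hpos : 0 < ‖orbitDeriv (EuclideanSpace ℝ (Fin d)) G y ξ‖ + 1 := by positivity
    refine (hε (δ / (‖orbitDeriv (EuclideanSpace ℝ (Fin d)) G y ξ‖ + 1)) (by positivity)).trans ?_
    rw [zero_add, div_mul_eq_mul_div, div_le_iff₀ hpos]
    nlinarith [norm_nonneg (orbitDeriv (EuclideanSpace ℝ (Fin d)) G y ξ)]
  refine le_antisymm (hle ξ) ?_
  have := hle (-ξ)
  rw [map_neg, inner_neg_right] at this
  linarith

variable [LieGroup 𝓘(ℝ, EuclideanSpace ℝ (Fin d)) 2 G]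

/-- Near a point of constant orbit type, the projections of the regular subgradients at `y` onto
the tangent space to the orbit of `x` are bounded in terms of the distance from `x` to `y`. -/
theorem exists_norm_starProjection_le_of_mem_regularSubdifferential
    (hsmooth : ContMDiff
      (𝓘(ℝ, EuclideanSpace ℝ (Fin d)).prod 𝓘(ℝ, EuclideanSpace ℝ (Fin n)))
      𝓘(ℝ, EuclideanSpace ℝ (Fin n)) 2 (fun p : G × EuclideanSpace ℝ (Fin n) => p.1 • p.2))
    {f : EuclideanSpace ℝ (Fin n) → EReal}
    (hinv : ∀ (g : G) (x : EuclideanSpace ℝ (Fin n)), f (g • x) = f x)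
    {x₀ : EuclideanSpace ℝ (Fin n)}
    (htype : ∀ᶠ y in 𝓝 x₀, orbitType G y = orbitType G x₀) :
    ∃ C : ℝ, ∃ U ∈ 𝓝 x₀, IsOpen U ∧ ∀ x ∈ U, ∀ y ∈ U, ∀ v ∈ regularSubdifferential f y,
      ‖(orbitTangentSpace (d := d) G x).starProjection v‖ ≤ C * (‖x - y‖ * ‖v‖) := by
  obtain ⟨L, t, ht, hL⟩ :=
    exists_lipschitzOnWith_orbitDeriv (E := EuclideanSpace ℝ (Fin d)) hsmooth x₀
  obtain ⟨C, hC, hpre⟩ := exists_bounded_preimage_of_finrank_range_le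
    (hL.continuousOn.continuousAt ht) (eventually_finrank_range_orbitDeriv_le hsmooth htype)
  obtain ⟨U, hUsub, hUopen, hxU⟩ := mem_nhds_iff.1 (inter_mem ht hpre)
  refine ⟨L * C, U, hUopen.mem_nhds hxU, hUopen, fun x hx y hy v hv => ?_⟩
  set p := (orbitTangentSpace (d := d) G x).starProjection v with hp
  have hpmem : p ∈ orbitTangentSpace (d := d) G x :=
    Submodule.starProjection_apply_mem _ v
  obtain ⟨h, hh, hhn⟩ := (hUsub hx).2 p hpmem
  have hsq : ‖p‖ * ‖p‖ = inner ℝ v p := by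
    rw [← real_inner_self_eq_norm_mul_norm]
    have := Submodule.starProjection_inner_eq_zero (K := orbitTangentSpace (d := d) G x) v p hpmem
    rw [← hp, inner_sub_left] at this
    linarith
  have hdiff : inner ℝ v p = inner ℝ v ((orbitDeriv (EuclideanSpace ℝ (Fin d)) G x
      - orbitDeriv (EuclideanSpace ℝ (Fin d)) G y) h) := by
    rw [sub_apply, inner_sub_right, hh,
      inner_orbitDeriv_eq_zero_of_mem_regularSubdifferential hsmooth hinv hv, sub_zero]
  have hlip : ‖orbitDeriv (EuclideanSpace ℝ (Fin d)) G x
      - orbitDeriv (EuclideanSpace ℝ (Fin d)) G y‖ ≤ L * ‖x - y‖ := by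
    simpa [dist_eq_norm] using hL.dist_le_mul x (hUsub hx).1 y (hUsub hy).1
  have hmain : ‖p‖ * ‖p‖ ≤ (L * C * (‖x - y‖ * ‖v‖)) * ‖p‖ := by
    rw [hsq, hdiff]
    calc _ ≤ ‖v‖ * ‖(orbitDeriv (EuclideanSpace ℝ (Fin d)) G x
          - orbitDeriv (EuclideanSpace ℝ (Fin d)) G y) h‖ := real_inner_le_norm _ _
      _ ≤ ‖v‖ * (L * ‖x - y‖ * (C * ‖p‖)) := by
          gcongr
          exact (ContinuousLinearMap.le_opNorm _ _).trans (by gcongr)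
      _ = _ := by ring
  rcases (norm_nonneg p).eq_or_lt with h0 | h0
  · rw [← h0]
    positivity
  · exact le_of_mul_le_mul_right hmain h0

end Subgradients

end OrbitalProjection

/-! ### Passage to limiting and horizon subgradients -/

theorem mainTheorem2 {d n : ℕ} (k : ℕ∞) (hk : 2 ≤ k)
    (G : Type*) [Group G] [TopologicalSpace G] [T2Space G] [SecondCountableTopology G]
    [ChartedSpace (EuclideanSpace ℝ (Fin d)) G]
    [LieGroup 𝓘(ℝ, EuclideanSpace ℝ (Fin d)) (k : WithTop ℕ∞) G]
    [MulAction G (EuclideanSpace ℝ (Fin n))]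
    (hsmooth : ContMDiff
      (𝓘(ℝ, EuclideanSpace ℝ (Fin d)).prod 𝓘(ℝ, EuclideanSpace ℝ (Fin n)))
      𝓘(ℝ, EuclideanSpace ℝ (Fin n)) (k : WithTop ℕ∞)
      (fun p : G × EuclideanSpace ℝ (Fin n) => p.1 • p.2))
    (f : EuclideanSpace ℝ (Fin n) → EReal)
    (hinv : ∀ (g : G) (x : EuclideanSpace ℝ (Fin n)), f (g • x) = f x)
    (xbar : EuclideanSpace ℝ (Fin n)) (hdom : f xbar < ⊤)
    (htyp : OrbitalProjection.TypicalAt G xbar) :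
    ∃ C : ℝ, ∃ U ∈ 𝓝 xbar, ∀ x ∈ U, f x < ⊤ → ∀ y ∈ U,
      (∀ v ∈ OrbitalProjection.subdifferential f y,
        ‖(OrbitalProjection.orbitTangentSpace (d := d) G x).starProjection v‖
          ≤ C * (‖x - y‖ * ‖v‖)) ∧
      (∀ w ∈ OrbitalProjection.horizonSubdifferential f y,
        ‖(OrbitalProjection.orbitTangentSpace (d := d) G x).starProjection w‖
          ≤ C * (‖x - y‖ * ‖w‖)) := by
  have h2 : (2 : WithTop ℕ∞) ≤ (k : WithTop ℕ∞) := WithTop.coe_le_coe.2 hk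
  have : LieGroup 𝓘(ℝ, EuclideanSpace ℝ (Fin d)) 2 G := LieGroup.of_le h2
  obtain ⟨C, U, hU, hUopen, hreg⟩ :=
    OrbitalProjection.exists_norm_starProjection_le_of_mem_regularSubdifferential (d := d)
      (hsmooth.of_le h2) hinv htyp.2
  refine ⟨C, U, hU, fun x hx _ y hy => ⟨?_, ?_⟩⟩
  · rintro v ⟨-, -, xs, vs, hvs, hxs, -, hlim⟩
    refine le_of_tendsto_of_tendsto
      (((OrbitalProjection.orbitTangentSpace (d := d) G x).starProjection.continuous.tendsto
        v).comp hlim).norm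
      (((tendsto_const_nhds.sub hxs).norm.mul hlim.norm).const_mul C) ?_
    -- As `U` is open, the approximating points eventually lie in it.
    filter_upwards [hxs.eventually (hUopen.mem_nhds hy)] with j hj
    exact hreg x hx _ hj _ (hvs j)
  · rintro w ⟨-, -, xs, vs, τ, hvs, hτ, -, hxs, -, hlim⟩
    refine le_of_tendsto_of_tendsto
      (((OrbitalProjection.orbitTangentSpace (d := d) G x).starProjection.continuous.tendsto
        w).comp hlim).norm
      (((tendsto_const_nhds.sub hxs).norm.mul hlim.norm).const_mul C) ?_
    filter_upwards [hxs.eventually (hUopen.mem_nhds hy)] with j hj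
    -- Both sides scale linearly in the subgradient, so the same `C` serves `τ j • vs j`.
    have := mul_le_mul_of_nonneg_left (hreg x hx _ hj _ (hvs j)) (hτ j).le
    rw [Function.comp_apply, map_smul, norm_smul, norm_smul, Real.norm_of_nonneg (hτ j).le]
    linarith
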